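/- Let $n\ge 3$ and let $P\subset\mathbb R^n$ be a polytope (the convex hull of finitely many points) containing the centered Euclidean ball $rB_2^n$, where $B_2^n=\{x\in\mathbb R^n:|x|\le 1\}$ and $\frac{3\sqrt3}{\sqrt n}\le r\le 1$. Let $\mathcal F$ be the set of facets of $P$, i.e. of its $(n-1)$-dimensional faces, and let $$N=N(P,B_2^n)=\min\Big\{N:\ \exists\, x_1,\dots,x_N\in\mathbb R^n,\ P\subset\bigcup_{i=1}^N (x_i+B_2^n)\Big\}$$ be the covering number of $P$ by unit Euclidean balls. If $3\le N<e^{n/8}$, then $\mathcal F$ is finite and $$|\mathcal F|>\left(\frac{1}{2\left(1-r\sqrt{1-\frac{4\log N}{n}}\right)}\right)^{\frac{n-1}{2}}.$$ In particular, if $r=1$, then $$|\mathcal F|\ge\left(\frac{n}{8\log N}\right)^{\frac{n-1}{2}}.$$ -/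

import Mathlib

/-- A polytope is the convex hull of finitely many points. -/
def IsPolytope {E : Type*} [AddCommGroup E] [Module ℝ E] (P : Set E) : Prop :=
  ∃ V : Finset E, P = convexHull ℝ (V : Set E)

/-- The facets of a set `P` in the space `E`: the non-empty faces of `P` (the subsets of `P` on
which some linear functional attains its maximum over `P`) of affine dimension `dim E - 1`. -/
def facets {E : Type*} [NormedAddCommGroup E] [NormedSpace ℝ E] (P : Set E) : Set (Set E) :=
  {F | F.Nonempty ∧ IsExposed ℝ P F ∧
    Module.finrank ℝ (vectorSpan ℝ F) + 1 = Module.finrank ℝ E}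

/-! Compare solid angles. Let `τ² = 1 - 4 log N / n` and push each direction out to the sphere of
radius `1 / τ`. A point there in `P` lies in one of `N` unit balls, so its angle to the centre has
sine at most `τ`. A point outside `P` is cut off by an extreme point `y` of the polar body; since
`‖y‖ ≤ 1 / r`, its angle to `y` has cosine at least `r * τ`, hence sine at most `ρ = √(1 - (r *
τ)²)`. These cones fill the ball, and a cone of half-angle with sine `ρ` takes at most the fraction
`ρ ^ m / 2` of it, where `m = n - 1` (`two_mul_volume_ballCone_le`). Extreme points of the polar
inject into facets, so `2 ≤ N τ ^ m + |F| ρ ^ m`. The choice of `τ` gives `N τ ^ m < 1`, hence `|F|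
> ρ ^ (-m)`. -/

open scoped RealInnerProductSpace Topology
open Set MeasureTheory

/-! ### Polar duality: extreme points of the polar body and facets -/

section Polar

variable {E : Type*} [NormedAddCommGroup E] [InnerProductSpace ℝ E]

/-- The one-sided polar of a set in an inner product space. -/
def polarBody (P : Set E) : Set E := {y | ∀ p ∈ P, ⟪y, p⟫ ≤ 1}

/-- The points of `P` on the hyperplane with normal `y` at level `1`. -/
def contactFace (P : Set E) (y : E) : Set E := {p ∈ P | ⟪y, p⟫ = 1}

theorem convex_polarBody (P : Set E) : Convex ℝ (polarBody P) := by
  intro x hx y hy a b ha hb hab p hp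
  rw [inner_add_left, real_inner_smul_left, real_inner_smul_left]
  nlinarith [hx p hp, hy p hp]

theorem isClosed_polarBody (P : Set E) : IsClosed (polarBody P) := by
  simp only [polarBody, ofPred_forall]
  exact isClosed_biInter fun p _ => isClosed_le (by fun_prop) continuous_const

theorem polarBody_convexHull (V : Set E) : polarBody (convexHull ℝ V) = polarBody V := by
  refine Subset.antisymm (fun y hy p hp => hy p (subset_convexHull ℝ V hp)) fun y hy p hp => ?_
  exact convexHull_min (t := {p | ⟪y, p⟫ ≤ 1}) hy
    (convex_halfSpace_le (innerₗ E y).isLinear 1) hp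

theorem norm_mul_le_one_of_mem_polarBody {P : Set E} {r : ℝ} (hr : 0 < r)
    (hball : Metric.closedBall 0 r ⊆ P) {y : E} (hy : y ∈ polarBody P) : r * ‖y‖ ≤ 1 := by
  rcases eq_or_ne y 0 with rfl | h0
  · simp
  have hn : 0 < ‖y‖ := norm_pos_iff.2 h0
  have := hy ((r / ‖y‖) • y) (hball (by
    rw [mem_closedBall_zero_iff, norm_smul, Real.norm_of_nonneg (by positivity)]
    field_simp; exact le_rfl))
  rw [real_inner_smul_right, real_inner_self_eq_norm_sq] at this
  calc r * ‖y‖ = r / ‖y‖ * ‖y‖ ^ 2 := by field_simp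
    _ ≤ 1 := this

variable [FiniteDimensional ℝ E]

theorem isCompact_polarBody {P : Set E} {r : ℝ} (hr : 0 < r)
    (hball : Metric.closedBall 0 r ⊆ P) : IsCompact (polarBody P) := by
  refine Metric.isCompact_of_isClosed_isBounded (isClosed_polarBody P)
    (Metric.isBounded_closedBall (x := (0 : E)) (r := 1 / r) |>.subset fun y hy => ?_)
  rw [mem_closedBall_zero_iff, le_div_iff₀ hr, mul_comm]
  exact norm_mul_le_one_of_mem_polarBody hr hball hy

theorem exists_mem_polarBody_one_lt_inner {P : Set E} (hconv : Convex ℝ P) (hcl : IsClosed P)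
    (h0 : 0 ∈ P) {x : E} (hx : x ∉ P) : ∃ y ∈ polarBody P, 1 < ⟪y, x⟫ := by
  obtain ⟨f, u, hf, hu⟩ := geometric_hahn_banach_closed_point hconv hcl hx
  have hu0 : 0 < u := by simpa using hf 0 h0
  refine ⟨u⁻¹ • (InnerProductSpace.toDual ℝ E).symm f, fun p hp => ?_, ?_⟩
  · rw [real_inner_smul_left, InnerProductSpace.toDual_symm_apply, inv_mul_le_iff₀ hu0, mul_one]
    exact (hf p hp).le
  · rw [real_inner_smul_left, InnerProductSpace.toDual_symm_apply, lt_inv_mul_iff₀ hu0, mul_one]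
    exact hu

/-- Krein–Milman: a bound `⟪y, x⟫ ≤ 1` at all extreme points would pass to the whole polar body,
contradicting separation. -/
theorem exists_extremePoint_polarBody_one_lt_inner {P : Set E} (hconv : Convex ℝ P)
    (hcl : IsClosed P) {r : ℝ} (hr : 0 < r) (hball : Metric.closedBall 0 r ⊆ P) {x : E}
    (hx : x ∉ P) : ∃ y ∈ (polarBody P).extremePoints ℝ, 1 < ⟪y, x⟫ := by
  by_contra! h
  obtain ⟨y, hy, hyx⟩ := exists_mem_polarBody_one_lt_inner hconv hcl
    (hball (Metric.mem_closedBall_self hr.le)) hx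
  rw [← closure_convexHull_extremePoints (isCompact_polarBody hr hball) (convex_polarBody P)] at hy
  have hsub : closure (convexHull ℝ ((polarBody P).extremePoints ℝ)) ⊆ {z : E | ⟪z, x⟫ ≤ 1} := by
    refine closure_minimal (convexHull_min h ?_) (isClosed_le (by fun_prop) continuous_const)
    simp_rw [real_inner_comm]
    exact convex_halfSpace_le (innerₗ E x).isLinear 1
  exact absurd (hsub hy) (not_le.2 hyx)

/-- Moving `y` by `± ε • d`, with `d` orthogonal to the contact points, keeps tight constraints
tight; the finitely many slack ones survive small `ε`. So `y` would be a midpoint in the polar. -/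
theorem span_contactFace_eq_top {V : Finset E} {y : E}
    (hy : y ∈ (polarBody (V : Set E)).extremePoints ℝ) :
    Submodule.span ℝ (contactFace (V : Set E) y) = ⊤ := by
  by_contra hne
  have hbot : (Submodule.span ℝ (contactFace (V : Set E) y))ᗮ ≠ ⊥ := fun h =>
    hne ((Submodule.orthogonal_eq_bot_iff).1 h)
  obtain ⟨d, hd, hd0⟩ := Submodule.exists_mem_ne_zero_of_ne_bot hbot
  have key : ∀ᶠ ε in 𝓝[>] (0 : ℝ), ∀ v ∈ V,
      ⟪y - ε • d, v⟫ ≤ 1 ∧ ⟪y + ε • d, v⟫ ≤ 1 := by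
    rw [Filter.eventually_all_finset]
    intro v hv
    by_cases hv1 : ⟪y, v⟫ = 1
    · have h0 : ⟪d, v⟫ = 0 := by
        rw [real_inner_comm]
        exact hd v (Submodule.subset_span ⟨hv, hv1⟩)
      exact Filter.Eventually.of_forall fun ε => by
        simp [inner_add_left, inner_sub_left, real_inner_smul_left, h0, hv1]
    · have hlt : ⟪y, v⟫ < 1 := lt_of_le_of_ne (hy.1 v hv) hv1
      refine Filter.Eventually.filter_mono nhdsWithin_le_nhds (Filter.Eventually.and ?_ ?_)
      · have hc : Continuous fun ε : ℝ => ⟪y - ε • d, v⟫ := by fun_prop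
        exact (hc.continuousAt.eventually_lt_const (by simpa using hlt)).mono fun _ h => h.le
      · have hc : Continuous fun ε : ℝ => ⟪y + ε • d, v⟫ := by fun_prop
        exact (hc.continuousAt.eventually_lt_const (by simpa using hlt)).mono fun _ h => h.le
  obtain ⟨ε, hε, hε0⟩ := (key.and self_mem_nhdsWithin).exists
  have hseg : y ∈ openSegment ℝ (y - ε • d) (y + ε • d) :=
    ⟨1 / 2, 1 / 2, by norm_num, by norm_num, by norm_num, by module⟩
  have := hy.2 (x₁ := y - ε • d) (fun v hv => (hε v hv).1) (x₂ := y + ε • d)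
    (fun v hv => (hε v hv).2) hseg
  rw [sub_eq_self, smul_eq_zero] at this
  exact this.elim (ne_of_gt hε0) hd0

theorem span_contactFace_convexHull_eq_top {V : Finset E} {y : E}
    (hy : y ∈ (polarBody (convexHull ℝ (V : Set E))).extremePoints ℝ) :
    Submodule.span ℝ (contactFace (convexHull ℝ (V : Set E)) y) = ⊤ := by
  rw [polarBody_convexHull] at hy
  rw [eq_top_iff, ← span_contactFace_eq_top hy]
  exact Submodule.span_mono fun p hp => ⟨subset_convexHull ℝ _ hp.1, hp.2⟩

theorem contactFace_mem_facets [Nontrivial E] {V : Finset E} {y : E}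
    (hy : y ∈ (polarBody (convexHull ℝ (V : Set E))).extremePoints ℝ) :
    contactFace (convexHull ℝ (V : Set E)) y ∈ facets (convexHull ℝ (V : Set E)) := by
  set P := convexHull ℝ (V : Set E)
  have hspan := span_contactFace_convexHull_eq_top hy
  have hne : (contactFace P y).Nonempty := by
    rw [nonempty_iff_ne_empty]
    intro h
    rw [h, Submodule.span_empty] at hspan
    exact bot_ne_top hspan
  obtain ⟨p, hp⟩ := hne
  refine ⟨⟨p, hp⟩, fun _ => ⟨innerSL ℝ y, ?_⟩, le_antisymm ?_ ?_⟩
  · ext q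
    simp only [contactFace, mem_ofPred_eq, innerSL_apply_apply, and_congr_right_iff]
    refine fun hq => ⟨fun h z hz => h ▸ hy.1 z hz, fun h => ?_⟩
    exact le_antisymm (hy.1 q hq) (hp.2 ▸ h p hp.1)
  -- `y` vanishes on differences of contact points but equals `1` at `p`, so the direction space is
  -- proper; adjoining `p` recovers the full span.
  · refine Submodule.finrank_lt fun htop => ?_
    have hle : vectorSpan ℝ (contactFace P y) ≤ (innerₗ E y).ker := by
      refine Submodule.span_le.2 ?_
      rintro _ ⟨a, ha, b, hb, rfl⟩
      simp [inner_sub_right, ha.2, hb.2]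
    have : p ∈ (innerₗ E y).ker := hle (htop ▸ Submodule.mem_top)
    have h1 := hp.2
    simp only [LinearMap.mem_ker, innerₗ_apply_apply] at this
    linarith
  · have hle : (⊤ : Submodule ℝ E) ≤ vectorSpan ℝ (contactFace P y) ⊔ Submodule.span ℝ {p} := by
      rw [← hspan, Submodule.span_le]
      intro q hq
      rw [← sub_add_cancel q p]
      exact Submodule.add_mem_sup (vsub_mem_vectorSpan ℝ hq hp)
        (Submodule.mem_span_singleton_self p)
    calc Module.finrank ℝ E = Module.finrank ℝ (⊤ : Submodule ℝ E) := (finrank_top ℝ E).symm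
      _ ≤ _ := Submodule.finrank_mono hle
      _ ≤ _ := Submodule.finrank_add_le_finrank_add_finrank _ _
      _ ≤ _ := by
        gcongr
        simpa using finrank_span_le_card (R := ℝ) ({p} : Set E)

theorem injOn_contactFace {V : Finset E} :
    InjOn (contactFace (convexHull ℝ (V : Set E)))
      ((polarBody (convexHull ℝ (V : Set E))).extremePoints ℝ) := by
  intro y hy z hz hyz
  have hspan := span_contactFace_convexHull_eq_top hy
  have heq : innerₗ E y = innerₗ E z := by
    refine LinearMap.ext_on hspan fun p hp => ?_
    simp only [innerₗ_apply_apply]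
    rw [hp.2, (hyz ▸ hp : p ∈ contactFace _ z).2]
  exact ext_inner_right ℝ fun v => by simpa using LinearMap.congr_fun heq v

end Polar

/-- A face is determined by its extreme points, which form a subset of `V`. -/
theorem finite_setOf_isExposed_convexHull {E : Type*} [NormedAddCommGroup E] [NormedSpace ℝ E]
    (V : Finset E) : {F | IsExposed ℝ (convexHull ℝ (V : Set E)) F}.Finite := by
  have hcomp : IsCompact (convexHull ℝ (V : Set E)) := V.finite_toSet.isCompact_convexHull ℝ
  refine Finite.of_finite_image (f := extremePoints ℝ)
    (V.finite_toSet.finite_subsets.subset ?_) ?_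
  · rintro _ ⟨F, (hF : IsExposed ℝ _ F), rfl⟩
    have hext : IsExtreme ℝ (convexHull ℝ (V : Set E)) F := IsExposed.isExtreme hF
    exact hext.extremePoints_subset_extremePoints.trans extremePoints_convexHull_subset
  · intro F (hF : IsExposed ℝ _ F) G (hG : IsExposed ℝ _ G) hFG
    rw [← closure_convexHull_extremePoints (hF.isCompact hcomp)
      (hF.convex (convex_convexHull ℝ _)), hFG,
      closure_convexHull_extremePoints (hG.isCompact hcomp) (hG.convex (convex_convexHull ℝ _))]

/-! ### Volume of a circular cone in the unit ball -/

theorem Real.sqrt_one_sub_mul_le {q s ρ : ℝ} (hq : 0 ≤ q) (hs : 0 ≤ s) (h : s ^ 2 + ρ ^ 2 = 1) :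
    √(1 - ρ ^ 2 * q) - s * √q ≤ √(1 - q) := by
  rw [sub_le_iff_le_add, Real.sqrt_le_left (by positivity)]
  have h1 : 1 - q ≤ √(1 - q) ^ 2 := by
    rcases le_total (1 - q) 0 with h0 | h0
    · exact h0.trans (sq_nonneg _)
    · rw [Real.sq_sqrt h0]
  have h2 : √q ^ 2 = q := Real.sq_sqrt hq
  have h3 : 0 ≤ √(1 - q) * (s * √q) := by positivity
  nlinarith

theorem measurableSet_coordinate_cone (m : ℕ) (s : ℝ) :
    MeasurableSet {p : ℝ × (Fin m → ℝ) | p.1 ^ 2 + ∑ i, p.2 i ^ 2 ≤ 1 ∧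
      s * √(p.1 ^ 2 + ∑ i, p.2 i ^ 2) ≤ p.1} := by
  have h1 : MeasurableSet {p : ℝ × (Fin m → ℝ) | p.1 ^ 2 + ∑ i, p.2 i ^ 2 ≤ 1} :=
    measurableSet_le (by fun_prop) (by fun_prop)
  have h2 : MeasurableSet {p : ℝ × (Fin m → ℝ) | s * √(p.1 ^ 2 + ∑ i, p.2 i ^ 2) ≤ p.1} :=
    measurableSet_le (by fun_prop) (by fun_prop)
  exact h1.inter h2

/-- The volume of the part of the unit ball at small angle to the first coordinate axis, bounded by
rescaling the remaining coordinates and comparing slices. -/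
theorem two_mul_volume_coordinate_cone_le (m : ℕ) {s ρ : ℝ} (hs : 0 ≤ s) (hρ : 0 < ρ)
    (h : s ^ 2 + ρ ^ 2 = 1) :
    2 * volume {p : ℝ × (Fin m → ℝ) | p.1 ^ 2 + ∑ i, p.2 i ^ 2 ≤ 1 ∧
        s * √(p.1 ^ 2 + ∑ i, p.2 i ^ 2) ≤ p.1} ≤
      ENNReal.ofReal (ρ ^ m) * volume {p : ℝ × (Fin m → ℝ) | p.1 ^ 2 + ∑ i, p.2 i ^ 2 ≤ 1} := by
  set C := {p : ℝ × (Fin m → ℝ) | p.1 ^ 2 + ∑ i, p.2 i ^ 2 ≤ 1 ∧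
        s * √(p.1 ^ 2 + ∑ i, p.2 i ^ 2) ≤ p.1}
  set B := {p : ℝ × (Fin m → ℝ) | p.1 ^ 2 + ∑ i, p.2 i ^ 2 ≤ 1} with hB
  have mB : MeasurableSet B := measurableSet_le (by fun_prop) (by fun_prop)
  have mC : MeasurableSet C := measurableSet_coordinate_cone m s
  -- The cone's slice over `ρ • y` has at most half the length of the ball's slice over `y`; the
  -- rescaling contributes the Jacobian `ρ ^ m`.
  have hslice : ∀ y : Fin m → ℝ, 2 * volume ((fun a : ℝ => (a, ρ • y)) ⁻¹' C) ≤
      volume ((fun a : ℝ => (a, y)) ⁻¹' B) := by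
    intro y
    set q := ∑ i, y i ^ 2 with hq
    have hq0 : 0 ≤ q := Finset.sum_nonneg fun i _ => sq_nonneg _
    have hρq : ∑ i, (ρ • y) i ^ 2 = ρ ^ 2 * q := by
      simp only [hq, Finset.mul_sum, Pi.smul_apply, smul_eq_mul, mul_pow]
    have h1 : (fun a : ℝ => (a, ρ • y)) ⁻¹' C ⊆ Icc (s * √q) (√(1 - ρ ^ 2 * q)) := by
      rintro a ⟨ha1, ha2⟩
      simp only [hρq] at ha1 ha2
      have ha0 : 0 ≤ a := le_trans (by positivity) ha2
      refine ⟨?_, Real.le_sqrt_of_sq_le (by linarith)⟩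
      have h3 : s ^ 2 * (a ^ 2 + ρ ^ 2 * q) ≤ a ^ 2 := by
        have := pow_le_pow_left₀ (by positivity) ha2 2
        rwa [mul_pow, Real.sq_sqrt (by positivity)] at this
      refine abs_le_of_sq_le_sq' ?_ ha0 |>.2
      rw [mul_pow, Real.sq_sqrt hq0]
      have : ρ ^ 2 * (s ^ 2 * q) ≤ ρ ^ 2 * a ^ 2 := by nlinarith
      exact le_of_mul_le_mul_left this (by positivity)
    have h2 : q ≤ 1 → Icc (-√(1 - q)) (√(1 - q)) ⊆ (fun a : ℝ => (a, y)) ⁻¹' B := by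
      intro hq1 a ha
      have := sq_le_sq' ha.1 ha.2
      rw [Real.sq_sqrt (by linarith)] at this
      change a ^ 2 + q ≤ 1
      linarith
    have h3 : ENNReal.ofReal (2 * √(1 - q)) ≤ volume ((fun a : ℝ => (a, y)) ⁻¹' B) := by
      rcases le_total q 1 with hq1 | hq1
      · refine le_trans (le_of_eq ?_) (measure_mono (h2 hq1))
        rw [Real.volume_Icc]; ring_nf
      · simp [Real.sqrt_eq_zero_of_nonpos (by linarith : 1 - q ≤ 0)]
    calc 2 * volume ((fun a : ℝ => (a, ρ • y)) ⁻¹' C)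
        ≤ 2 * volume (Icc (s * √q) (√(1 - ρ ^ 2 * q))) := by gcongr
      _ ≤ 2 * ENNReal.ofReal (√(1 - q)) := by
        rw [Real.volume_Icc]
        gcongr
        exact Real.sqrt_one_sub_mul_le hq0 hs h
      _ = ENNReal.ofReal (2 * √(1 - q)) := by
        rw [ENNReal.ofReal_mul (by norm_num)]; simp
      _ ≤ _ := h3
  have hscale : volume C = ENNReal.ofReal (ρ ^ m) *
      ∫⁻ y : Fin m → ℝ, volume ((fun a : ℝ => (a, ρ • y)) ⁻¹' C) := by
    rw [Measure.volume_eq_prod, Measure.prod_apply_symm mC]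
    have hmap := Measure.map_addHaar_smul (volume : Measure (Fin m → ℝ)) hρ.ne'
    have hf : Measurable fun y : Fin m → ℝ => volume ((fun a : ℝ => (a, y)) ⁻¹' C) :=
      measurable_measure_prodMk_right mC
    rw [← lintegral_map (f := fun y : Fin m → ℝ => volume ((fun a : ℝ => (a, y)) ⁻¹' C)) hf
      (measurable_const_smul ρ), hmap, lintegral_smul_measure, smul_eq_mul, ← mul_assoc,
      Module.finrank_fin_fun, abs_of_pos (by positivity), ← ENNReal.ofReal_mul (by positivity),
      mul_inv_cancel₀ (by positivity), ENNReal.ofReal_one, one_mul]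
  calc 2 * volume C = ENNReal.ofReal (ρ ^ m) *
        ∫⁻ y : Fin m → ℝ, 2 * volume ((fun a : ℝ => (a, ρ • y)) ⁻¹' C) := by
        rw [hscale, lintegral_const_mul' _ _ (by simp)]; ring
    _ ≤ ENNReal.ofReal (ρ ^ m) * ∫⁻ y : Fin m → ℝ, volume ((fun a : ℝ => (a, y)) ⁻¹' B) := by
        gcongr with y
        exact hslice y
    _ = _ := by rw [Measure.volume_eq_prod, Measure.prod_apply_symm mB]

/-- The part of the unit ball in the cone of vectors whose angle with `u` has cosine at
least `s`. -/
def ballCone {E : Type*} [NormedAddCommGroup E] [InnerProductSpace ℝ E] (s : ℝ) (u : E) : Set E :=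
  {x | ‖x‖ ≤ 1 ∧ s * (‖x‖ * ‖u‖) ≤ ⟪x, u⟫}

theorem two_mul_volume_ballCone_le {m : ℕ} {s ρ : ℝ} (hs : 0 ≤ s) (hρ : 0 < ρ)
    (h : s ^ 2 + ρ ^ 2 = 1) {u : EuclideanSpace ℝ (Fin (m + 1))} (hu : u ≠ 0) :
    2 * volume (ballCone s u) ≤ ENNReal.ofReal (ρ ^ m) *
      volume (Metric.closedBall (0 : EuclideanSpace ℝ (Fin (m + 1))) 1) := by
  have hun : 0 < ‖u‖ := norm_pos_iff.2 hu
  have hon : Orthonormal ℝ (({0} : Set (Fin (m + 1))).domRestrict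
      fun _ => (‖u‖⁻¹ • u : EuclideanSpace ℝ (Fin (m + 1)))) := by
    refine ⟨fun i => ?_, fun i j hij => absurd (Subsingleton.elim i j) hij⟩
    simp [norm_smul, hun.ne']
  obtain ⟨b, hb⟩ := hon.exists_orthonormalBasis_extension_of_card_eq (by simp)
  have hb0 : b 0 = ‖u‖⁻¹ • u := hb 0 rfl
  have hΦ : MeasurePreserving (fun x : EuclideanSpace ℝ (Fin (m + 1)) =>
      ((b.repr x).ofLp 0, fun i : Fin m => (b.repr x).ofLp i.succ)) volume volume :=
    (volume_preserving_piFinSuccAbove (fun _ : Fin (m + 1) => ℝ) 0).comp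
      ((PiLp.volume_preserving_ofLp (Fin (m + 1))).comp b.measurePreserving_repr)
  have hnorm : ∀ x : EuclideanSpace ℝ (Fin (m + 1)),
      (b.repr x).ofLp 0 ^ 2 + ∑ i : Fin m, (b.repr x).ofLp i.succ ^ 2 = ‖x‖ ^ 2 := by
    intro x
    rw [← b.repr.norm_map x, EuclideanSpace.real_norm_sq_eq, Fin.sum_univ_succ]
  have hinner : ∀ x, ⟪x, u⟫ = ‖u‖ * (b.repr x).ofLp 0 := by
    intro x
    rw [b.repr_apply_apply, hb0, real_inner_smul_left, real_inner_comm, mul_inv_cancel_left₀ hun.ne']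
  have key := two_mul_volume_coordinate_cone_le m hs hρ h
  have mB : MeasurableSet {p : ℝ × (Fin m → ℝ) | p.1 ^ 2 + ∑ i, p.2 i ^ 2 ≤ 1} :=
    measurableSet_le (by fun_prop) (by fun_prop)
  rw [← hΦ.measure_preimage mB.nullMeasurableSet, ← hΦ.measure_preimage
    (measurableSet_coordinate_cone m s).nullMeasurableSet] at key
  convert key using 4
  · ext x
    simp only [ballCone, mem_ofPred_eq, preimage_ofPred_eq, hnorm, hinner,
      Real.sqrt_sq (norm_nonneg _), sq_le_one_iff₀ (norm_nonneg x)]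
    refine and_congr_right fun _ => ?_
    rw [show s * (‖x‖ * ‖u‖) = ‖u‖ * (s * ‖x‖) by ring, mul_le_mul_iff_right₀ hun]
  · ext x
    simp only [mem_closedBall_zero_iff, mem_ofPred_eq, preimage_ofPred_eq, hnorm,
      sq_le_one_iff₀ (norm_nonneg x)]

/-! ### Covering the ball by cones, and the count -/

theorem exists_isCover_encard_eq_externalCoveringNumber {X : Type*} [PseudoEMetricSpace X]
    (ε : NNReal) (A : Set X) :
    ∃ C, Metric.IsCover ε A C ∧ C.encard = Metric.externalCoveringNumber ε A := by
  have : Nonempty {C : Set X // Metric.IsCover ε A C} := ⟨⟨A, Metric.IsCover.refl ε A⟩⟩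
  obtain ⟨C, hC⟩ :=
    ENat.exists_eq_iInf fun C : {C : Set X // Metric.IsCover ε A C} => (C : Set X).encard
  exact ⟨C, C.2, hC.trans iInf_subtype⟩

theorem mem_ballCone_of_dist_le {E : Type*} [NormedAddCommGroup E] [InnerProductSpace ℝ E]
    {t τ : ℝ} (ht : 0 < t) (hτ : 0 < τ) (h : t ^ 2 + τ ^ 2 = 1) {x c : E} (hx : x ≠ 0)
    (hx1 : ‖x‖ ≤ 1) (hc : dist ((τ * ‖x‖)⁻¹ • x) c ≤ 1) : c ≠ 0 ∧ x ∈ ballCone t c := by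
  have hxn : 0 < ‖x‖ := norm_pos_iff.2 hx
  have hz : τ * ‖(τ * ‖x‖)⁻¹ • x‖ = 1 := by
    rw [norm_smul, norm_inv, Real.norm_of_nonneg (by positivity)]
    field_simp
  have hxz : x = (τ * ‖x‖) • ((τ * ‖x‖)⁻¹ • x) := by
    rw [smul_smul, mul_inv_cancel₀ (by positivity), one_smul]
  set z := (τ * ‖x‖)⁻¹ • x
  have hd : ‖z‖ ^ 2 - 2 * ⟪z, c⟫ + ‖c‖ ^ 2 ≤ 1 := by
    rw [← norm_sub_sq_real, ← dist_eq_norm]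
    exact pow_le_one₀ dist_nonneg hc
  have hτz : τ ^ 2 * ‖z‖ ^ 2 = 1 := by rw [← mul_pow, hz, one_pow]
  refine ⟨?_, hx1, ?_⟩
  · rintro rfl
    simp only [inner_zero_right, norm_zero] at hd
    nlinarith [mul_le_mul_of_nonneg_left hd (sq_nonneg τ), pow_pos ht 2]
  · have h1 : t * ‖c‖ ≤ τ * ⟪z, c⟫ := by
      -- As `‖z‖ = 1 / τ`, `hd` gives `2τ²⟪z, c⟫ ≥ t² + τ²‖c‖²`, and AM-GM finishes.
      have : τ * (t * ‖c‖) ≤ τ * (τ * ⟪z, c⟫) := by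
        nlinarith [mul_le_mul_of_nonneg_left hd (sq_nonneg τ), sq_nonneg (t - τ * ‖c‖)]
      exact le_of_mul_le_mul_left this hτ
    have h2 : ⟪x, c⟫ = τ * ‖x‖ * ⟪z, c⟫ := by
      conv_lhs => rw [hxz]
      rw [real_inner_smul_left]
    rw [h2]
    nlinarith [mul_le_mul_of_nonneg_left h1 hxn.le]

theorem mem_ballCone_of_one_lt_inner {E : Type*} [NormedAddCommGroup E] [InnerProductSpace ℝ E]
    {r τ : ℝ} (hτ : 0 < τ) {x y : E} (hx1 : ‖x‖ ≤ 1) (hx : x ≠ 0) (hy : r * ‖y‖ ≤ 1)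
    (hxy : 1 < ⟪y, (τ * ‖x‖)⁻¹ • x⟫) : x ∈ ballCone (r * τ) y := by
  have hxn : 0 < ‖x‖ := norm_pos_iff.2 hx
  rw [real_inner_smul_right, lt_inv_mul_iff₀ (by positivity), mul_one, real_inner_comm] at hxy
  refine ⟨hx1, le_trans ?_ hxy.le⟩
  nlinarith [mul_le_mul_of_nonneg_left hy (by positivity : 0 ≤ τ * ‖x‖)]

theorem two_mul_measure_biUnion_le_ncard_mul {α ι : Type*} [MeasurableSpace α] (μ : Measure α) {S : Set ι}
    (hS : S.Finite) (f : ι → Set α) {a : ENNReal} (hf : ∀ i ∈ S, 2 * μ (f i) ≤ a) :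
    2 * μ (⋃ i ∈ S, f i) ≤ S.ncard * a := by
  obtain ⟨T, rfl⟩ := hS.exists_finset_coe
  calc 2 * μ (⋃ i ∈ (T : Set ι), f i) ≤ 2 * ∑ i ∈ T, μ (f i) := by
        gcongr
        exact measure_biUnion_finset_le T f
    _ = ∑ i ∈ T, 2 * μ (f i) := Finset.mul_sum _ _ _
    _ ≤ ∑ i ∈ T, a := Finset.sum_le_sum hf
    _ = _ := by simp [ncard_coe_finset]

/-- A polytope containing a ball: every point outside is cut off by a facet, so on the sphere of
radius `1 / τ` the caps behind the facets and the caps in the covering balls have at least full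
measure. -/
theorem two_le_ncard_mul_pow_add_ncard_facets_mul_pow {m : ℕ}
    {V : Finset (EuclideanSpace ℝ (Fin (m + 1)))} {r t τ ρ : ℝ} (hr : 0 < r) (ht : 0 < t)
    (hτ : 0 < τ) (hρ : 0 < ρ) (htτ : t ^ 2 + τ ^ 2 = 1) (hrρ : (r * τ) ^ 2 + ρ ^ 2 = 1)
    (hball : Metric.closedBall 0 r ⊆ convexHull ℝ (V : Set (EuclideanSpace ℝ (Fin (m + 1)))))
    {C : Set (EuclideanSpace ℝ (Fin (m + 1)))} (hCfin : C.Finite)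
    (hC : Metric.IsCover 1 (convexHull ℝ (V : Set (EuclideanSpace ℝ (Fin (m + 1))))) C) :
    2 ≤ C.ncard * τ ^ m +
      (facets (convexHull ℝ (V : Set (EuclideanSpace ℝ (Fin (m + 1)))))).ncard * ρ ^ m := by
  set P := convexHull ℝ (V : Set (EuclideanSpace ℝ (Fin (m + 1))))
  set X := (polarBody P).extremePoints ℝ
  set B := Metric.closedBall (0 : EuclideanSpace ℝ (Fin (m + 1))) 1 with hB
  have hfac : (facets P).Finite := (finite_setOf_isExposed_convexHull V).subset fun F hF => hF.2.1
  have hmaps : MapsTo (contactFace P) X (facets P) := fun y hy => contactFace_mem_facets hy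
  have hXfin : X.Finite := Finite.of_injOn hmaps injOn_contactFace hfac
  have hXcard : X.ncard ≤ (facets P).ncard :=
    ncard_le_ncard_of_injOn _ hmaps injOn_contactFace hfac
  have hPcl : IsClosed P := V.finite_toSet.isClosed_convexHull ℝ
  have hX0 : ∀ y ∈ X, y ≠ 0 := by
    rintro _ hy rfl
    obtain ⟨p, hp⟩ := (hmaps hy).1
    simpa using hp.2
  -- A centre at `0` is dropped: its `ballCone` is the whole ball, and it reaches no point of norm
  -- `1 / τ > 1`.
  have hsub : B \ {0} ⊆ (⋃ c ∈ C \ {0}, ballCone t c) ∪ ⋃ y ∈ X, ballCone (r * τ) y := by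
    rintro x ⟨hx1, hx0⟩
    rw [hB, mem_closedBall_zero_iff] at hx1
    by_cases hz : (τ * ‖x‖)⁻¹ • x ∈ P
    · obtain ⟨c, hc, hzc⟩ := hC hz
      have hd : dist ((τ * ‖x‖)⁻¹ • x) c ≤ 1 := by
        have : edist ((τ * ‖x‖)⁻¹ • x) c ≤ 1 := by simpa using hzc
        rw [edist_dist] at this
        simpa using this
      obtain ⟨hc0, hxc⟩ := mem_ballCone_of_dist_le ht hτ htτ hx0 hx1 hd
      exact Or.inl (mem_biUnion (show c ∈ C \ {0} from ⟨hc, hc0⟩) hxc)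
    · obtain ⟨y, hy, hyz⟩ :=
        exists_extremePoint_polarBody_one_lt_inner (convex_convexHull ℝ _) hPcl hr hball hz
      exact Or.inr (mem_biUnion hy (mem_ballCone_of_one_lt_inner hτ hx1 hx0
        (norm_mul_le_one_of_mem_polarBody hr hball hy.1) hyz))
  have hB0 : volume B ≠ 0 := (Metric.measure_closedBall_pos volume _ one_pos).ne'
  have hBtop : volume B ≠ ⊤ := measure_closedBall_lt_top.ne
  have hvol : 2 * volume B ≤
      (ENNReal.ofReal (C.ncard * τ ^ m + (facets P).ncard * ρ ^ m)) * volume B := by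
    calc 2 * volume B = 2 * volume (B \ {0}) := by rw [measure_sdiff_null (measure_singleton 0)]
      _ ≤ 2 * (volume (⋃ c ∈ C \ {0}, ballCone t c) + volume (⋃ y ∈ X, ballCone (r * τ) y)) := by
        gcongr
        exact (measure_mono hsub).trans (measure_union_le _ _)
      _ ≤ ((C \ {0}).ncard : ENNReal) * (ENNReal.ofReal (τ ^ m) * volume B) +
          X.ncard * (ENNReal.ofReal (ρ ^ m) * volume B) := by
        rw [mul_add]
        exact add_le_add
          (two_mul_measure_biUnion_le_ncard_mul _ (hCfin.subset sdiff_subset) _ fun c hc =>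
            two_mul_volume_ballCone_le ht.le hτ htτ hc.2)
          (two_mul_measure_biUnion_le_ncard_mul _ hXfin _ fun y hy =>
            two_mul_volume_ballCone_le (by positivity) hρ hrρ (hX0 y hy))
      _ ≤ (C.ncard : ENNReal) * (ENNReal.ofReal (τ ^ m) * volume B) +
          (facets P).ncard * (ENNReal.ofReal (ρ ^ m) * volume B) := by
        gcongr
        exact sdiff_subset
      _ = _ := by
        rw [ENNReal.ofReal_add (by positivity) (by positivity), ENNReal.ofReal_mul (by positivity),
          ENNReal.ofReal_mul (by positivity), ENNReal.ofReal_natCast, ENNReal.ofReal_natCast]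
        ring
  rw [ENNReal.mul_le_mul_iff_left hB0 hBtop] at hvol
  simpa using (ENNReal.le_ofReal_iff_toReal_le (by simp) (by positivity)).1 hvol

/-- From `1 - a ≤ exp (-a)`, the square is at most `N ^ (2 - 4m / (m + 1))`, whose exponent is
negative once `m > 1`. -/
theorem natCast_mul_pow_lt_one {N m : ℕ} {τ : ℝ} (hN : 1 < N) (hm : 2 ≤ m) (hτ : 0 < τ)
    (h : τ ^ 2 = 1 - 4 * Real.log N / (m + 1 : ℕ)) : N * τ ^ m < 1 := by
  have hN0 : (0 : ℝ) < N := by positivity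
  have hL : 0 < Real.log N := Real.log_pos (by exact_mod_cast hN)
  have hm' : (2 : ℝ) ≤ m := by exact_mod_cast hm
  refine lt_of_pow_lt_pow_left₀ 2 zero_le_one ?_
  have h1 : τ ^ 2 ≤ Real.exp (-(4 * Real.log N / (m + 1 : ℕ))) := by
    rw [h]
    linarith [Real.add_one_le_exp (-(4 * Real.log N / (m + 1 : ℕ)))]
  calc (N * τ ^ m) ^ 2 = N ^ 2 * (τ ^ 2) ^ m := by ring
    _ ≤ N ^ 2 * Real.exp (-(4 * Real.log N / (m + 1 : ℕ))) ^ m := by gcongr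
    _ = Real.exp (2 * Real.log N + m * -(4 * Real.log N / (m + 1 : ℕ))) := by
      have : Real.exp (2 * Real.log N) = N ^ 2 := by
        rw [two_mul, Real.exp_add, Real.exp_log hN0, sq]
      rw [Real.exp_add, ← Real.exp_nat_mul, this]
    _ < 1 ^ 2 := by
      rw [one_pow, Real.exp_lt_one_iff]
      push_cast
      have : 2 * Real.log N + m * -(4 * Real.log N / (m + 1)) =
          -(2 * Real.log N * (m - 1) / (m + 1)) := by field_simp; ring
      rw [this, neg_lt_zero]
      have : (0 : ℝ) < m - 1 := by linarith
      positivity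

theorem theorem1 (n : ℕ) (hn : 3 ≤ n) (P : Set (EuclideanSpace ℝ (Fin n))) (hP : IsPolytope P)
    (r : ℝ) (hr : 3 * Real.sqrt 3 / Real.sqrt (n : ℝ) ≤ r) (hr1 : r ≤ 1)
    (hball : Metric.closedBall (0 : EuclideanSpace ℝ (Fin n)) r ⊆ P)
    (N : ℕ) (hN : Metric.externalCoveringNumber 1 P = (N : ℕ∞))
    (hN3 : 3 ≤ N) (hNexp : (N : ℝ) < Real.exp ((n : ℝ) / 8)) :
    (facets P).Finite ∧
    ((facets P).ncard : ℝ) >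
      (1 / (2 * (1 - r * Real.sqrt (1 - 4 * Real.log (N : ℝ) / (n : ℝ))))) ^
        (((n : ℝ) - 1) / 2) ∧
    (r = 1 →
      ((facets P).ncard : ℝ) ≥
        ((n : ℝ) / (8 * Real.log (N : ℝ))) ^ (((n : ℝ) - 1) / 2)) := by
  obtain ⟨m, rfl⟩ : ∃ m, n = m + 1 := ⟨n - 1, by omega⟩
  obtain ⟨V, rfl⟩ := hP
  have hr0 : 0 < r := lt_of_lt_of_le (by positivity) hr
  have hn0 : (0 : ℝ) < (m + 1 : ℕ) := by positivity
  have hN0 : (0 : ℝ) < N := by positivity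
  have hL : 0 < Real.log N := Real.log_pos (by exact_mod_cast (by omega : 1 < N))
  have hL8 : Real.log N < (m + 1 : ℕ) / 8 := (Real.log_lt_iff_lt_exp hN0).2 hNexp
  set a := 4 * Real.log N / (m + 1 : ℕ) with ha
  have ha0 : 0 < a := by positivity
  have ha1 : a < 1 / 2 := by
    rw [ha, div_lt_iff₀ hn0]
    linarith
  set τ := √(1 - a) with hτ
  have hτ0 : 0 < τ := Real.sqrt_pos.2 (by linarith)
  have hτsq : τ ^ 2 = 1 - a := Real.sq_sqrt (by linarith)
  have hτ1 : τ < 1 := by nlinarith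
  have hs0 : 0 < r * τ := by positivity
  have hs1 : r * τ < 1 := by nlinarith
  have hρ0 : 0 < 1 - (r * τ) ^ 2 := by nlinarith
  obtain ⟨C, hC, hCN⟩ : ∃ C, Metric.IsCover 1
      (convexHull ℝ (V : Set (EuclideanSpace ℝ (Fin (m + 1))))) C ∧ C.encard = N := by
    rw [← hN]
    exact exists_isCover_encard_eq_externalCoveringNumber _ _
  have hCfin : C.Finite := finite_of_encard_eq_coe hCN
  have hCcard : C.ncard = N := by rw [ncard, hCN]; rfl
  have hmain := two_le_ncard_mul_pow_add_ncard_facets_mul_pow hr0 (Real.sqrt_pos.2 ha0) hτ0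
    (Real.sqrt_pos.2 hρ0) (by rw [Real.sq_sqrt ha0.le, hτsq]; ring)
    (by rw [Real.sq_sqrt hρ0.le]; ring) hball hCfin hC
  have hNτ := natCast_mul_pow_lt_one (by omega : 1 < N) (by omega : 2 ≤ m) hτ0 hτsq
  rw [hCcard] at hmain
  set M : ℝ := ((facets (convexHull ℝ (V : Set (EuclideanSpace ℝ (Fin (m + 1)))))).ncard : ℝ)
  have hexp : (((m + 1 : ℕ) : ℝ) - 1) / 2 = m / 2 := by push_cast; ring
  have hstrict : (1 / (2 * (1 - r * τ))) ^ ((((m + 1 : ℕ) : ℝ) - 1) / 2) < M := by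
    have hpow : √(1 - (r * τ) ^ 2) ^ m = (1 - (r * τ) ^ 2) ^ ((m : ℝ) / 2) := by
      rw [Real.sqrt_eq_rpow, ← Real.rpow_mul_natCast hρ0.le]
      ring_nf
    calc (1 / (2 * (1 - r * τ))) ^ ((((m + 1 : ℕ) : ℝ) - 1) / 2)
        ≤ (1 / (1 - (r * τ) ^ 2)) ^ ((m : ℝ) / 2) := by
          rw [hexp]
          have : 0 ≤ 1 / (2 * (1 - r * τ)) := by
            have : 0 < 1 - r * τ := by linarith
            positivity
          gcongr
          -- `1 - s² = (1 - s)(1 + s) ≤ 2 (1 - s)` with `s = r * τ < 1`.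
          nlinarith
      _ = 1 / √(1 - (r * τ) ^ 2) ^ m := by rw [Real.div_rpow one_pos.le hρ0.le, Real.one_rpow, hpow]
      _ < M := by
        rw [div_lt_iff₀ (by positivity)]
        linarith
  refine ⟨(finite_setOf_isExposed_convexHull V).subset fun F hF => hF.2.1, hstrict, ?_⟩
  rintro rfl
  refine le_trans ?_ hstrict.le
  -- `τ² ≤ τ` and `τ² = 1 - a`.
  have h1 : 1 - τ ≤ a := by nlinarith
  have h2 : ((m + 1 : ℕ) : ℝ) / (8 * Real.log N) = 1 / (2 * a) := by rw [ha]; field_simp; norm_num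
  rw [h2, hexp, one_mul]
  have : 0 < 1 - τ := by linarith
  gcongr
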